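/- **Conventions.** A Hilbert–Schmidt operator $H$ on $L^2(\mathbb R)$ is a bounded operator of the form $Hf(x)=\int\kappa_H(x,t)f(t)\,dt$ with $\kappa_H\in L^2(\mathbb R^2)$, and $\|H\|_{HS}=\|\kappa_H\|_{L^2(\mathbb R^2)}$. Its Kohn–Nirenberg symbol is $\sigma_H(x,\xi)=\int\kappa_H(x,x-t)e^{-2\pi i t\xi}\,dt$ and its spreading function is $\eta_H=\mathcal F_s\sigma_H$, where $\mathcal F_s\sigma(t,\nu)=\iint\sigma(x,\xi)e^{-2\pi i(\nu x-\xi t)}\,dx\,d\xi$ (both transforms in the $L^2$ sense). For $S\subseteq\mathbb R^2$, $OPW(S)$ is the set of Hilbert–Schmidt operators $H$ with $\operatorname{supp}\eta_H\subseteq S$. For a tempered distribution $f$, the tempered distribution $Hf$ is given weakly by $Hf=\iint\eta_H(t,\nu)\,M_\nu T_tf\,dt\,d\nu$, that is, $(Hf)(g)=\iint\eta_H(t,\nu)\,(M_\nu T_tf)(g)\,dt\,d\nu$ for all Schwartz functions $g$, where $T_tf=f(\cdot-t)$ and $M_\nu f=e^{2\pi i\nu\,\cdot}f$. Finally, $f^{(r)}$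 is the $r$-th distributional derivative of $f$ and $\delta_a$ the Dirac delta at $a$. **Theorem.** Let $M,N\ge1$ be integers. There are constants $c,C>0$, depending only on $M$ and $N$, such that for every $H\in OPW\big([0,N]\times[-\tfrac M2,\tfrac M2]\big)$ the tempered distributions $H\sum_{k\in\mathbb Z}\delta_{kN}^{(r)}$, $r\ge0$, are well defined (the integrals above converge absolutely and define tempered distributions), the distributions $$u_j=\sum_{r=0}^{j}\binom jr(-1)^r\Big(H\sum_{k\in\mathbb Z}\delta_{kN}^{(r)}\Big)^{(j-r)},\qquad 0\le j\le MN-1,$$ belong to $L^2(\mathbb R)$, and $$c\,\|H\|_{HS}^2\;\le\;\sum_{j=0}^{MN-1}\|u_j\|_{L^2(\mathbb R)}^2\;\le\;C\,\|H\|_{HS}^2 .$$ -/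

import Mathlib

open MeasureTheory SchwartzMap TemperedDistribution FourierTransform Topology Complex

noncomputable section

namespace OperatorSampling

/-! ### The Fourier transform on `L²(ℝ²)` and supports -/

/-- `L²(ℝ)`, complex valued. -/
abbrev L2R : Type := Lp ℂ 2 (volume : Measure ℝ)

/-- `L²(ℝ²)`, complex valued, with respect to Lebesgue measure on the plane. -/
abbrev L2R2 : Type := Lp ℂ 2 (volume : Measure (ℝ × ℝ))

/-- The (unitary) Fourier transform of `L²(ℝ²)`, the extension by continuity of
`f ↦ ∫∫ f(y₁, y₂) e^{-2πi (y₁ ω₁ + y₂ ω₂)} dy₁ dy₂`. It is Mathlib's Fourier transform on the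
Euclidean plane `WithLp 2 (ℝ × ℝ)`, transported along the (measure preserving) identity. -/
def planeFourier (f : L2R2) : L2R2 :=
  Lp.compMeasurePreserving (WithLp.toLp 2) (WithLp.volume_preserving_toLp ℝ ℝ)
    (𝓕 (Lp.compMeasurePreserving (WithLp.ofLp (p := 2)) (WithLp.volume_preserving_ofLp ℝ ℝ) f) :
      Lp ℂ 2 (volume : Measure (WithLp 2 (ℝ × ℝ))))

theorem measurePreserving_rotate :
    MeasurePreserving (fun p : ℝ × ℝ => (p.2, -p.1)) (volume : Measure (ℝ × ℝ)) volume := by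
  have h1 : MeasurePreserving (Prod.swap : ℝ × ℝ → ℝ × ℝ) volume volume :=
    Measure.measurePreserving_swap
  have h2 : MeasurePreserving (Prod.map (id : ℝ → ℝ) (fun t : ℝ => -t))
      (volume : Measure (ℝ × ℝ)) volume :=
    (MeasurePreserving.id volume).prod (Measure.measurePreserving_neg volume)
  exact h2.comp h1

/-- The symplectic Fourier transform
`(F_s f)(t, ν) = ∫∫ f(x, ξ) e^{-2πi (ν x - ξ t)} dx dξ` on `L²(ℝ²)`,
that is, `(F_s f)(t, ν) = (F f)(ν, -t)`. -/
def symplecticFourier (f : L2R2) : L2R2 :=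
  Lp.compMeasurePreserving (fun p : ℝ × ℝ => (p.2, -p.1)) measurePreserving_rotate
    (planeFourier f)

/-- The (essential) support of a function given up to null sets: the complement of the largest
open set on which the function vanishes almost everywhere. -/
def essSupp (f : ℝ × ℝ → ℂ) : Set (ℝ × ℝ) :=
  {p | ∀ U ∈ 𝓝 p, ¬ ∀ᵐ q ∂(volume.restrict U), f q = 0}

/-! ### Hilbert-Schmidt operators and operator Paley-Wiener spaces -/

/-- A Hilbert-Schmidt operator on `L²(ℝ)`: a bounded operator `H` with
`(H f)(x) = ∫ κ(x, t) f(t) dt` for a kernel `κ ∈ L²(ℝ²)` (which is determined by `H`). -/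
structure HilbertSchmidtOperator where
  /-- the underlying bounded operator -/
  toCLM : L2R →L[ℂ] L2R
  /-- the integral kernel -/
  kernel : L2R2
  apply_ae : ∀ f : L2R, ∀ᵐ x : ℝ, toCLM f x = ∫ t : ℝ, kernel (x, t) * f t

namespace HilbertSchmidtOperator

/-- The Hilbert-Schmidt norm `‖H‖_HS = ‖κ_H‖_{L²(ℝ²)}`. -/
def hsNorm (H : HilbertSchmidtOperator) : ℝ := ‖H.kernel‖

/-- `σ` is the Kohn-Nirenberg symbol `σ_H(x, ξ) = ∫ κ_H(x, x - t) e^{-2πi t ξ} dt` of `H`: for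
almost every `x`, the function `t ↦ κ_H(x, x - t)` is in `L²(ℝ)` and `σ(x, ·)` is its
Fourier-Plancherel transform. -/
def IsKohnNirenbergSymbol (H : HilbertSchmidtOperator) (σ : L2R2) : Prop :=
  ∀ᵐ x : ℝ, ∃ hx : MemLp (fun t : ℝ => H.kernel (x, x - t)) 2 volume,
    (fun ξ : ℝ => σ (x, ξ)) =ᵐ[volume] (𝓕 hx.toLp : L2R)

/-- `η` is the spreading function `η_H = F_s σ_H` of `H`. -/
def IsSpreadingFunction (H : HilbertSchmidtOperator) (η : L2R2) : Prop :=
  ∃ σ : L2R2, H.IsKohnNirenbergSymbol σ ∧ η = symplecticFourier σ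

end HilbertSchmidtOperator

/-- The operator Paley-Wiener space `OPW(S)`: the Hilbert-Schmidt operators `H` with
`supp F_s σ_H ⊆ S`. -/
def OPW (S : Set (ℝ × ℝ)) : Set HilbertSchmidtOperator :=
  {H | ∃ η : L2R2, H.IsSpreadingFunction η ∧ essSupp η ⊆ S}

/-! ### Action on tempered distributions -/

/-- The time shift `T_t f = f(· - t)` of a tempered distribution:
`(T_t f)(g) = f(g(· + t))`. -/
def timeShift (t : ℝ) (f : 𝓢'(ℝ, ℂ)) : 𝓢'(ℝ, ℂ) :=
  PointwiseConvergenceCLM.precomp ℂ (SchwartzMap.compSubConstCLM ℂ (-t)) f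

/-- The frequency shift `M_ν f = e^{2πi ν ·} f` of a tempered distribution. -/
def freqShift (ν : ℝ) (f : 𝓢'(ℝ, ℂ)) : 𝓢'(ℝ, ℂ) :=
  TemperedDistribution.smulLeftCLM ℂ (fun x : ℝ => exp (2 * Real.pi * I * ν * x)) f

theorem hasTemperateGrowth_char (ν : ℝ) :
    Function.HasTemperateGrowth (fun x : ℝ => exp (2 * Real.pi * I * ν * x)) := by
  have key : ∀ n : ℕ, iteratedDeriv n (fun x : ℝ => exp (2 * Real.pi * I * ν * x)) =
      fun x : ℝ => (2 * Real.pi * I * ν) ^ n * exp (2 * Real.pi * I * ν * x) := by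
    intro n
    induction n with
    | zero => simp
    | succ n ih =>
      rw [iteratedDeriv_succ, ih]
      funext x
      have h1 : HasDerivAt (fun x : ℝ => 2 * Real.pi * I * ν * (x : ℂ))
          (2 * Real.pi * I * ν) x := by
        simpa using (Complex.ofRealCLM.hasDerivAt (x := x)).const_mul (2 * Real.pi * I * ν : ℂ)
      have h2 := (h1.cexp).const_mul ((2 * Real.pi * I * ν : ℂ) ^ n)
      rw [h2.deriv]
      ring
  refine ⟨((contDiff_const.mul Complex.ofRealCLM.contDiff).cexp :), fun n => ⟨0, ‖(2 * Real.pi * I * ν : ℂ) ^ n‖, fun x => ?_⟩⟩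
  rw [norm_iteratedFDeriv_eq_norm_iteratedDeriv, key]
  have : (2 * Real.pi * I * ν * x : ℂ) = ((2 * Real.pi * ν * x : ℝ) : ℂ) * I := by
    push_cast; ring
  rw [norm_mul, this, Complex.norm_exp_ofReal_mul_I]
  simp

/-- The frequency shift acts on test functions by multiplication with `e^{2πi ν ·}`, and the time
shift by translation. -/
theorem freqShift_timeShift_apply (t ν : ℝ) (f : 𝓢'(ℝ, ℂ)) (g g' : 𝓢(ℝ, ℂ))
    (hg : ∀ y : ℝ, g' y = exp (2 * Real.pi * I * ν * ((y + t : ℝ) : ℂ)) * g (y + t)) :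
    freqShift ν (timeShift t f) g = f g' := by
  change f (SchwartzMap.compSubConstCLM ℂ (-t) (SchwartzMap.smulLeftCLM ℂ _ g)) = f g'
  congr 1
  ext y
  rw [SchwartzMap.compSubConstCLM_apply,
    SchwartzMap.smulLeftCLM_apply_apply (hasTemperateGrowth_char ν), hg y, sub_neg_eq_add,
    smul_eq_mul]

/-- The tempered distribution `T` is `H f`, where `f` is a tempered distribution: the identity
`H f = ∫∫ η_H(t, ν) M_ν T_t f dt dν` holds weakly, that is, for every test function `g` the
function `(t, ν) ↦ η_H(t, ν) (M_ν T_t f)(g)` is integrable and its integral is `T(g)`. -/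
def HilbertSchmidtOperator.MapsTo (H : HilbertSchmidtOperator) (f T : 𝓢'(ℝ, ℂ)) : Prop :=
  ∃ η : L2R2, H.IsSpreadingFunction η ∧ ∀ g : 𝓢(ℝ, ℂ),
    Integrable (fun p : ℝ × ℝ => η p * freqShift p.2 (timeShift p.1 f) g) volume ∧
    T g = ∫ p : ℝ × ℝ, η p * freqShift p.2 (timeShift p.1 f) g

/-- The `r`-th distributional derivative `f^{(r)}` of a tempered distribution `f`. -/
def distDeriv (r : ℕ) (f : 𝓢'(ℝ, ℂ)) : 𝓢'(ℝ, ℂ) :=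
  (TemperedDistribution.derivCLM ℂ)^[r] f

/-- The impulse train `∑_k δ_{kN}^{(r)}` of `r`-th derivatives of Dirac deltas; the series
converges in the space of tempered distributions. -/
def impulseTrain (N r : ℕ) : 𝓢'(ℝ, ℂ) :=
  ∑' k : ℤ, distDeriv r (TemperedDistribution.delta ((k : ℝ) * N))

/-- The measure `∑_k δ_{kN}` has temperate growth. -/
theorem hasTemperateGrowth_comb (N : ℕ) (hN : 0 < N) :
    (Measure.sum fun k : ℤ => Measure.dirac ((k : ℝ) * N)).HasTemperateGrowth := by
  refine ⟨⟨2, ⟨(by fun_prop : Measurable _).aestronglyMeasurable, ?_⟩⟩⟩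
  rw [HasFiniteIntegral, lintegral_sum_measure]
  simp only [lintegral_dirac]
  have hb : Summable fun k : ℤ => (1 + ‖(k : ℝ) * N‖) ^ (-((2 : ℕ) : ℝ)) := by
    have h0 : Summable fun k : ℤ => 1 / (k : ℝ) ^ 2 :=
      Real.summable_one_div_int_pow.mpr one_lt_two
    refine (h0.add (summable_of_hasFiniteSupport (f := fun k : ℤ => if k = 0 then (1 : ℝ) else 0)
      ((Set.finite_singleton (0 : ℤ)).subset fun k hk => by
        by_contra h; simp_all))).of_nonneg_of_le (fun k => by positivity) fun k => ?_
    rw [Real.rpow_neg (by positivity), Real.rpow_natCast]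
    by_cases hk : k = 0
    · simp [hk]
    · have hk' : (0 : ℝ) < |(k : ℝ)| := by positivity
      have hN' : (1 : ℝ) ≤ N := by exact_mod_cast hN
      have hle : |(k : ℝ)| ≤ 1 + ‖(k : ℝ) * N‖ := by
        rw [Real.norm_eq_abs, abs_mul, Nat.abs_cast]
        nlinarith
      rw [if_neg hk, add_zero, one_div, ← sq_abs (k : ℝ)]
      gcongr
  have hfin := hb.tsum_ofReal_lt_top
  refine lt_of_le_of_lt (le_of_eq ?_) hfin
  congr 1
  funext k
  exact Real.enorm_of_nonneg (by positivity)

/-- The series that defines the impulse train is convergent. -/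
theorem summable_impulseTrain (N r : ℕ) (hN : 0 < N) :
    Summable fun k : ℤ => distDeriv r (TemperedDistribution.delta ((k : ℝ) * N)) := by
  have hμ := hasTemperateGrowth_comb N hN
  have h0 : Summable fun k : ℤ => TemperedDistribution.delta ((k : ℝ) * N) := by
    refine ⟨(Measure.sum fun k : ℤ => Measure.dirac ((k : ℝ) * N)).toTemperedDistribution, ?_⟩
    refine PointwiseConvergenceCLM.tendsto_iff_forall_tendsto.mpr fun g => ?_
    have h1 := hasSum_integral_measure (μ := fun k : ℤ => Measure.dirac ((k : ℝ) * N))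
      (SchwartzMap.integrable g)
    simp only [integral_dirac] at h1
    refine Filter.Tendsto.congr (fun s => ?_) h1
    induction s using Finset.induction_on with
    | empty => rfl
    | insert a s ha ih => rw [Finset.sum_insert ha, Finset.sum_insert ha, ih]; rfl
  induction r with
  | zero => exact h0
  | succ r ih =>
    have h2 := ih.mapL (TemperedDistribution.derivCLM ℂ)
    simpa only [distDeriv, Function.iterate_succ_apply'] using h2

end OperatorSampling

end

open OperatorSampling

/-! Write `η` for the spreading function. Pairing `M_ν T_t ∑ δ_{kN}` with a test function samples it
at the points `t + kN`, weighted by `e^{2πiν(t + kN)}`. The support of `η` has width `N` in `t`, so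
these points cover the line once, and `H ∑ δ_{kN}` is a function. More generally let `w_l` be
`bandMoment`, the same function with the extra weight `(2πiν)^l` in the integral.

Since `M_ν T_t f' = (D - 2πiν) M_ν T_t f`, the binomial theorem gives `H ∑ δ_{kN}^{(r)} = ∑_l C(r,l)
(-1)^l D^{r-l} w_l` (`mapsTo_impulseTrain`). The combination defining `u_j` is the inverse binomial
transform, hence `u_j = w_j` (`sum_choose_distDeriv_inversion`).

It remains to compare the norms of `w_0, …, w_{MN-1}` with that of `η`. For fixed `t`, the values
`w_l(t + kN)` are Fourier integrals at frequencies `kN`, which see `ν` only modulo `1/N`. The band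
of length `M` folds onto `MN` cells of length `1/N`, and Parseval turns the `MN` moments into a
Vandermonde system in the `MN` folded values (`tsum_enorm_sq_moment`). Its nodes `2πi(ν + m/N)` are
distinct and range over a compact set, so the system is bounded above and below uniformly in `ν`.
Integrating over `t` and using Plancherel, `‖η‖ = ‖H‖_HS` (`norm_eq_of_isSpreadingFunction`), gives
both inequalities. -/

noncomputable section

namespace OperatorSampling

/-! ### Modulated translates of test functions and impulse trains -/

/-- The operator on test functions that is dual to `M_ν T_t`. -/
def modTranslate (t ν : ℝ) : 𝓢(ℝ, ℂ) →L[ℂ] 𝓢(ℝ, ℂ) :=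
  (SchwartzMap.compSubConstCLM ℂ (-t)).comp
    (SchwartzMap.smulLeftCLM ℂ (fun x : ℝ => exp (2 * Real.pi * I * ν * x)))

theorem modTranslate_apply (t ν : ℝ) (g : 𝓢(ℝ, ℂ)) (y : ℝ) :
    modTranslate t ν g y = exp (2 * Real.pi * I * ν * ((y + t : ℝ) : ℂ)) * g (y + t) := by
  change SchwartzMap.compSubConstCLM ℂ (-t) (SchwartzMap.smulLeftCLM ℂ _ g) y = _
  rw [SchwartzMap.compSubConstCLM_apply,
    SchwartzMap.smulLeftCLM_apply_apply (hasTemperateGrowth_char ν), sub_neg_eq_add, smul_eq_mul]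

theorem freqShift_timeShift_eq (t ν : ℝ) (f : 𝓢'(ℝ, ℂ)) (g : 𝓢(ℝ, ℂ)) :
    freqShift ν (timeShift t f) g = f (modTranslate t ν g) :=
  freqShift_timeShift_apply t ν f g _ fun y => modTranslate_apply t ν g y

theorem derivCLM_modTranslate (t ν : ℝ) (g : 𝓢(ℝ, ℂ)) :
    SchwartzMap.derivCLM ℂ ℂ (modTranslate t ν g) =
      (2 * Real.pi * I * ν : ℂ) • modTranslate t ν g +
        modTranslate t ν (SchwartzMap.derivCLM ℂ ℂ g) := by
  ext y
  have h1 : HasDerivAt (fun y : ℝ => 2 * Real.pi * I * ν * ((y + t : ℝ) : ℂ))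
      (2 * Real.pi * I * ν) y := by
    simpa using ((((hasDerivAt_id y).add_const t).ofReal_comp).const_mul
      (2 * Real.pi * I * ν : ℂ))
  have h2 : HasDerivAt (fun y : ℝ => g (y + t)) (deriv g (y + t)) y :=
    (g.differentiableAt (x := y + t)).hasDerivAt.comp_add_const y t
  have h3 := (h1.cexp.mul h2).deriv
  have h4 : (⇑(modTranslate t ν g) : ℝ → ℂ) =
      (fun y : ℝ => exp (2 * Real.pi * I * ν * ((y + t : ℝ) : ℂ))) * fun y => g (y + t) :=
    funext fun y => modTranslate_apply t ν g y
  rw [SchwartzMap.derivCLM_apply, h4, h3]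
  simp only [add_apply, smul_apply, modTranslate_apply,
    SchwartzMap.derivCLM_apply, smul_eq_mul]
  ring

/-- The product rule reads `D ∘ A = A ∘ (2πiν + D)` with `A` the modulated translation. So `A`
intertwines the powers as well, and the scalar commutes with `D`, which makes the binomial theorem
available. -/
theorem iterate_derivCLM_modTranslate (t ν : ℝ) (g : 𝓢(ℝ, ℂ)) (r : ℕ) :
    (SchwartzMap.derivCLM ℂ ℂ)^[r] (modTranslate t ν g) =
      ∑ l ∈ Finset.range (r + 1), ((r.choose l : ℂ) * (2 * Real.pi * I * ν) ^ l) •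
        modTranslate t ν ((SchwartzMap.derivCLM ℂ ℂ)^[r - l] g) := by
  let D : Module.End ℂ 𝓢(ℝ, ℂ) := (SchwartzMap.derivCLM ℂ ℂ : 𝓢(ℝ, ℂ) →L[ℂ] 𝓢(ℝ, ℂ))
  let A : Module.End ℂ 𝓢(ℝ, ℂ) := (modTranslate t ν : 𝓢(ℝ, ℂ) →L[ℂ] 𝓢(ℝ, ℂ))
  let a : Module.End ℂ 𝓢(ℝ, ℂ) := algebraMap ℂ _ (2 * Real.pi * I * ν : ℂ)
  have hD : ∀ (n : ℕ) f, (SchwartzMap.derivCLM ℂ ℂ)^[n] f = (D ^ n) f := fun n f => by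
    rw [Module.End.pow_apply]; rfl
  have h1 : SemiconjBy A (a + D) D := by
    refine LinearMap.ext fun f => ?_
    have := derivCLM_modTranslate t ν f
    change modTranslate t ν ((2 * Real.pi * I * ν : ℂ) • f + SchwartzMap.derivCLM ℂ ℂ f) =
      SchwartzMap.derivCLM ℂ ℂ (modTranslate t ν f)
    rw [this, map_add, map_smul]
  have h2 := LinearMap.congr_fun (h1.pow_right r).eq g
  have h3 : Commute a D := Algebra.commutes _ _
  rw [h3.add_pow] at h2
  rw [hD]
  refine h2.symm.trans ?_
  rw [Finset.mul_sum, LinearMap.sum_apply]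
  refine Finset.sum_congr rfl fun l _ => ?_
  have h4 : a ^ l * D ^ (r - l) * (r.choose l : Module.End ℂ 𝓢(ℝ, ℂ)) =
      ((r.choose l : ℂ) * (2 * Real.pi * I * ν) ^ l) • D ^ (r - l) := by
    rw [← map_pow, ← map_natCast (algebraMap ℂ (Module.End ℂ 𝓢(ℝ, ℂ))),
      ← Algebra.commutes (R := ℂ), ← mul_assoc, ← map_mul, ← Algebra.smul_def]
  rw [h4, hD]
  simp only [Module.End.mul_apply, LinearMap.smul_apply, map_smul]
  rfl

theorem distDeriv_apply (r : ℕ) (f : 𝓢'(ℝ, ℂ)) (g : 𝓢(ℝ, ℂ)) :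
    distDeriv r f g = (-1) ^ r * f ((SchwartzMap.derivCLM ℂ ℂ)^[r] g) := by
  induction r generalizing g with
  | zero => simp [distDeriv]
  | succ r ih =>
    have : distDeriv (r + 1) f = TemperedDistribution.derivCLM ℂ (distDeriv r f) :=
      Function.iterate_succ_apply' _ _ _
    rw [this, TemperedDistribution.derivCLM_apply_apply, map_neg, ih, pow_succ,
      Function.iterate_succ_apply]
    ring

theorem hasSum_impulseTrain (N : ℕ) (hN : 0 < N) (g : 𝓢(ℝ, ℂ)) :
    HasSum (fun k : ℤ => g ((k : ℝ) * N)) (impulseTrain N 0 g) := by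
  have h := (summable_impulseTrain N 0 hN).hasSum
  have h1 := PointwiseConvergenceCLM.tendsto_iff_forall_tendsto.mp h g
  refine Filter.Tendsto.congr (fun s => ?_) h1
  induction s using Finset.induction_on with
  | empty => rfl
  | insert a s ha ih => rw [Finset.sum_insert ha, Finset.sum_insert ha, ← ih]; rfl

theorem impulseTrain_eq_distDeriv (N r : ℕ) (hN : 0 < N) :
    impulseTrain N r = distDeriv r (impulseTrain N 0) := by
  induction r with
  | zero => rfl
  | succ r ih =>
    have h2 := (TemperedDistribution.derivCLM ℂ).map_tsum (summable_impulseTrain N r hN)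
    have h3 : distDeriv (r + 1) (impulseTrain N 0) =
        TemperedDistribution.derivCLM ℂ (distDeriv r (impulseTrain N 0)) :=
      Function.iterate_succ_apply' _ _ _
    rw [h3, ← ih]
    refine Eq.trans ?_ h2.symm
    exact tsum_congr fun k => Function.iterate_succ_apply' _ _ _

theorem impulseTrain_modTranslate (N r : ℕ) (hN : 0 < N) (t ν : ℝ) (g : 𝓢(ℝ, ℂ)) :
    impulseTrain N r (modTranslate t ν g) =
      ∑ l ∈ Finset.range (r + 1), (-1) ^ r * ((r.choose l : ℂ) * (2 * Real.pi * I * ν) ^ l) *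
        impulseTrain N 0 (modTranslate t ν ((SchwartzMap.derivCLM ℂ ℂ)^[r - l] g)) := by
  rw [impulseTrain_eq_distDeriv N r hN, distDeriv_apply, iterate_derivCLM_modTranslate, map_sum,
    Finset.mul_sum]
  exact Finset.sum_congr rfl fun l _ => by rw [map_smul, smul_eq_mul]; ring

/-- Binomial inversion for the powers of a linear operator. -/
theorem sum_choose_iterate_inversion {V : Type*} [AddCommGroup V] [Module ℂ V] (D : V →ₗ[ℂ] V)
    (W : ℕ → V) (j : ℕ) :
    ∑ r ∈ Finset.range (j + 1), ((j.choose r : ℂ) * (-1) ^ r) • (D ^ (j - r))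
      (∑ l ∈ Finset.range (r + 1), ((r.choose l : ℂ) * (-1) ^ l) • (D ^ (r - l)) (W l)) = W j := by
  -- On sequences, let `E` apply `D` termwise and `S` shift the index. The inner sum is `(E - S)^r
  -- W` at index `0`, and the outer one is then `(E - (E - S))^j W = S^j W` at index `0`, which is
  -- `W j`.
  let E : Module.End ℂ (ℕ → V) := D.compLeft ℕ
  let S : Module.End ℂ (ℕ → V) := LinearMap.funLeft ℂ V Nat.succ
  have hE : ∀ n (X : ℕ → V) i, (E ^ n) X i = (D ^ n) (X i) := fun n => by
    induction n with
    | zero => intros; rfl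
    | succ n ih =>
      intro X i
      rw [pow_succ', pow_succ', Module.End.mul_apply, Module.End.mul_apply, ← ih]; rfl
  have hS : ∀ n (X : ℕ → V) i, (S ^ n) X i = X (i + n) := fun n => by
    induction n with
    | zero => intros; rfl
    | succ n ih =>
      intro X i
      rw [pow_succ, Module.End.mul_apply, ih, ← Nat.add_assoc]; rfl
  have hc : Commute E S := LinearMap.ext fun X => rfl
  have hc' : Commute (-S) E := hc.symm.neg_left
  have hbin : ∀ (A : Module.End ℂ (ℕ → V)), Commute (-A) E → ∀ (n : ℕ) (X : ℕ → V) (i : ℕ),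
      ((-A + E) ^ n) X i = ∑ r ∈ Finset.range (n + 1), ((n.choose r : ℂ) * (-1) ^ r) •
        (D ^ (n - r)) ((A ^ r) X i) := by
    intro A hA n X i
    rw [hA.add_pow, LinearMap.sum_apply, Finset.sum_apply]
    refine Finset.sum_congr rfl fun r _ => ?_
    rw [(hA.pow_pow r (n - r)).eq, ← neg_one_smul ℂ A, smul_pow,
      ← map_natCast (algebraMap ℂ (Module.End ℂ (ℕ → V))), ← Algebra.commutes (R := ℂ),
      ← Algebra.smul_def, mul_smul_comm, smul_smul, LinearMap.smul_apply, Pi.smul_apply,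
      Module.End.mul_apply, hE]
  have h1 := hbin (-S + E) ((hc'.add_left (Commute.refl E)).neg_left) j W 0
  have h2 : -(-S + E) + E = S := by abel
  rw [h2, hS, zero_add] at h1
  rw [h1]
  refine Finset.sum_congr rfl fun r _ => ?_
  rw [hbin S hc' r W 0]
  simp only [hS, zero_add]

theorem sum_choose_distDeriv_inversion (W : ℕ → 𝓢'(ℝ, ℂ)) (j : ℕ) :
    ∑ r ∈ Finset.range (j + 1), ((j.choose r : ℂ) * (-1) ^ r) • distDeriv (j - r)
      (∑ l ∈ Finset.range (r + 1), ((r.choose l : ℂ) * (-1) ^ l) • distDeriv (r - l) (W l)) =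
        W j := by
  let D : 𝓢'(ℝ, ℂ) →ₗ[ℂ] 𝓢'(ℝ, ℂ) := (TemperedDistribution.derivCLM ℂ : 𝓢'(ℝ, ℂ) →L[ℂ] 𝓢'(ℝ, ℂ))
  have hD : ∀ n f, distDeriv n f = (D ^ n) f := fun n f => by
    rw [Module.End.pow_apply]; rfl
  simp only [hD]
  exact sum_choose_iterate_inversion D W j

/-! ### Uniform bounds for Vandermonde systems -/

theorem enorm_sq_eq_ofReal (z : ℂ) : ‖z‖ₑ ^ 2 = ENNReal.ofReal (‖z‖ ^ 2) := by
  rw [← ofReal_norm, ENNReal.ofReal_pow (norm_nonneg _)]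

/-- Compactness: the right side is continuous on interval times unit sphere and never vanishes
there, because `d ≠ 0` keeps the nodes distinct and the Vandermonde matrix invertible. A positive
lower bound on this compact set extends to all vectors by homogeneity. -/
theorem exists_vandermonde_lower_bound (n : ℕ) (a b d : ℝ) (hd : d ≠ 0) :
    ∃ c : ℝ, 0 < c ∧ ∀ ν ∈ Set.Icc a b, ∀ v : ℕ → ℂ,
      c * ∑ m ∈ Finset.range n, ‖v m‖ ^ 2 ≤ ∑ j ∈ Finset.range n,
        ‖∑ m ∈ Finset.range n, (2 * Real.pi * I * ((ν + m * d : ℝ) : ℂ)) ^ j * v m‖ ^ 2 := by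
  let z : ℝ → Fin n → ℂ := fun ν m => 2 * Real.pi * I * ((ν + m * d : ℝ) : ℂ)
  let F : ℝ × EuclideanSpace ℂ (Fin n) → ℝ := fun p =>
    ∑ j : Fin n, ‖∑ m : Fin n, z p.1 m ^ (j : ℕ) * p.2 m‖ ^ 2
  have hF : Continuous F := by
    simp only [F, z]
    fun_prop
  have hK : IsCompact (Set.Icc a b ×ˢ Metric.sphere (0 : EuclideanSpace ℂ (Fin n)) 1) :=
    isCompact_Icc.prod (isCompact_sphere _ _)
  have hz : ∀ ν, Function.Injective (z ν) := by
    intro ν m m' h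
    have h2 : (2 * Real.pi * I : ℂ) ≠ 0 := Complex.two_pi_I_ne_zero
    have h3 := mul_left_cancel₀ h2 h
    have h4 := Complex.ofReal_injective h3
    have h5 := mul_right_cancel₀ hd (add_left_cancel h4)
    exact Fin.ext (by exact_mod_cast h5)
  have hpos : ∀ p ∈ Set.Icc a b ×ˢ Metric.sphere (0 : EuclideanSpace ℂ (Fin n)) 1, 0 < F p := by
    rintro ⟨ν, x⟩ ⟨-, hx⟩
    by_contra hle
    have h0 : F (ν, x) = 0 := le_antisymm (not_lt.mp hle) (by positivity)
    rw [Finset.sum_eq_zero_iff_of_nonneg fun _ _ => by positivity] at h0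
    have h1 : (Matrix.vandermonde (z ν)).transpose.mulVec (WithLp.ofLp x) = 0 := by
      funext j
      have := h0 j (Finset.mem_univ j)
      rw [sq_eq_zero_iff, norm_eq_zero] at this
      simpa [Matrix.mulVec, dotProduct, Matrix.vandermonde_apply] using this
    have h2 := Matrix.eq_zero_of_mulVec_eq_zero
      (by rw [Matrix.det_transpose]; exact Matrix.det_vandermonde_ne_zero_iff.mpr (hz ν)) h1
    have h3 : x = 0 := by ext i; exact congrFun h2 i
    simp [h3] at hx
  obtain ⟨c, hc, hcF⟩ := hK.exists_forall_le' hF.continuousOn hpos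
  refine ⟨c, hc, fun ν hν v => ?_⟩
  let x : EuclideanSpace ℂ (Fin n) := WithLp.toLp 2 fun m : Fin n => v m
  have hx : ∑ m ∈ Finset.range n, ‖v m‖ ^ 2 = ‖x‖ ^ 2 := by
    rw [EuclideanSpace.norm_sq_eq, ← Fin.sum_univ_eq_sum_range fun m => ‖v m‖ ^ 2]
  have hFx : ∑ j ∈ Finset.range n,
      ‖∑ m ∈ Finset.range n, (2 * Real.pi * I * ((ν + m * d : ℝ) : ℂ)) ^ j * v m‖ ^ 2 =
        F (ν, x) := by
    rw [← Fin.sum_univ_eq_sum_range fun j =>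
      ‖∑ m ∈ Finset.range n, (2 * Real.pi * I * ((ν + m * d : ℝ) : ℂ)) ^ j * v m‖ ^ 2]
    refine Finset.sum_congr rfl fun j _ => ?_
    rw [← Fin.sum_univ_eq_sum_range fun m =>
      (2 * Real.pi * I * ((ν + m * d : ℝ) : ℂ)) ^ (j : ℕ) * v m]
  rw [hx, hFx]
  rcases eq_or_ne x 0 with h0 | h0
  · rw [h0, norm_zero]
    simpa using (show 0 ≤ F (ν, 0) by positivity)
  · have hn : 0 < ‖x‖ := norm_pos_iff.mpr h0
    have h1 := hcF (ν, ((‖x‖⁻¹ : ℝ) : ℂ) • x) ⟨hν, by simp [norm_smul, hn.ne']⟩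
    have h2 : F (ν, ((‖x‖⁻¹ : ℝ) : ℂ) • x) = (‖x‖ ^ 2)⁻¹ * F (ν, x) := by
      simp only [F, PiLp.smul_apply, smul_eq_mul, mul_left_comm _ ((‖x‖⁻¹ : ℝ) : ℂ),
        ← Finset.mul_sum, norm_mul, mul_pow]
      congr 1
      rw [Complex.norm_real, norm_inv, norm_norm, inv_pow]
    rw [h2, ← div_eq_inv_mul, le_div_iff₀ (by positivity)] at h1
    exact h1

theorem exists_vandermonde_upper_bound (n j : ℕ) (a b d : ℝ) :
    ∃ C : ℝ, 0 < C ∧ ∀ ν ∈ Set.Icc a b, ∀ v : ℕ → ℂ,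
      ‖∑ m ∈ Finset.range n, (2 * Real.pi * I * ((ν + m * d : ℝ) : ℂ)) ^ j * v m‖ ^ 2 ≤
        C * ∑ m ∈ Finset.range n, ‖v m‖ ^ 2 := by
  set R : ℝ := 2 * Real.pi * (|a| + |b| + n * |d|) + 1 with hR
  have hR0 : 0 < R := by positivity
  -- Cauchy–Schwarz gives the factor `n`; `n + 1` keeps the constant positive when `n = 0`.
  refine ⟨(n + 1) * (R ^ j) ^ 2, by positivity, fun ν hν v => ?_⟩
  have hz : ∀ m ∈ Finset.range n, ‖(2 * Real.pi * I * ((ν + m * d : ℝ) : ℂ))‖ ≤ R := by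
    intro m hm
    have hm' : (m : ℝ) ≤ n := by exact_mod_cast (Finset.mem_range.mp hm).le
    have h1 : |ν + m * d| ≤ |a| + |b| + n * |d| := by
      refine (abs_add_le _ _).trans (add_le_add ?_ ?_)
      · refine (abs_le_max_abs_abs hν.1 hν.2).trans (max_le ?_ ?_) <;> simp
      · rw [abs_mul, Nat.abs_cast]
        gcongr
    rw [norm_mul, Complex.norm_real, Real.norm_eq_abs, norm_mul, Complex.norm_I, mul_one, norm_mul,
      Complex.norm_real, Real.norm_of_nonneg Real.pi_pos.le, Complex.norm_ofNat, hR]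
    have : 2 * Real.pi * |ν + m * d| ≤ 2 * Real.pi * (|a| + |b| + n * |d|) := by gcongr
    linarith
  calc _ ≤ (∑ m ∈ Finset.range n, R ^ j * ‖v m‖) ^ 2 := by
        gcongr
        refine (norm_sum_le _ _).trans (Finset.sum_le_sum fun m hm => ?_)
        rw [norm_mul, norm_pow]
        gcongr
        exact hz m hm
    _ ≤ n * ∑ m ∈ Finset.range n, (R ^ j * ‖v m‖) ^ 2 := by
        simpa using sq_sum_le_card_mul_sum_sq (s := Finset.range n) (f := fun m => R ^ j * ‖v m‖)
    _ = n * (R ^ j) ^ 2 * ∑ m ∈ Finset.range n, ‖v m‖ ^ 2 := by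
        simp only [mul_pow, ← Finset.mul_sum, mul_assoc]
    _ ≤ _ := by gcongr; linarith

/-! ### Folding an interval -/

theorem map_add_restrict_Ioc (a b c : ℝ) :
    (volume.restrict (Set.Ioc a b)).map (fun x : ℝ => x + c) =
      volume.restrict (Set.Ioc (a + c) (b + c)) := by
  have h := Measure.restrict_map (μ := (volume : Measure ℝ)) (f := fun x : ℝ => x + c)
    (by fun_prop) (measurableSet_Ioc (a := a + c) (b := b + c))
  rw [map_add_right_eq_self, Set.preimage_add_const_Ioc] at h
  simpa using h.symm

/-- Half-open cells tile the interval exactly, so folding is an identity of measures. -/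
theorem restrict_Ioc_eq_sum_map (a d : ℝ) (hd : 0 ≤ d) (n : ℕ) :
    volume.restrict (Set.Ioc a (a + n * d)) =
      ∑ m ∈ Finset.range n, (volume.restrict (Set.Ioc a (a + d))).map
        (fun x : ℝ => x + m * d) := by
  induction n with
  | zero => simp
  | succ n ih =>
    rw [Finset.sum_range_succ, ← ih, map_add_restrict_Ioc, ← Measure.restrict_union
      (Set.Ioc_disjoint_Ioc_of_le le_rfl) measurableSet_Ioc, add_right_comm a d,
      Set.Ioc_union_Ioc_eq_Ioc (by simp; positivity) (by linarith)]
    push_cast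
    ring_nf

theorem map_restrict_le (a d : ℝ) (hd : 0 ≤ d) {m n : ℕ} (hm : m < n) :
    (volume.restrict (Set.Ioc a (a + d))).map (fun x : ℝ => x + m * d) ≤
      volume.restrict (Set.Ioc a (a + n * d)) := by
  rw [restrict_Ioc_eq_sum_map a d hd n]
  exact Finset.single_le_sum (f := fun m : ℕ => (volume.restrict (Set.Ioc a (a + d))).map
    (fun x : ℝ => x + m * d)) (fun _ _ => bot_le) (Finset.mem_range.mpr hm)

theorem memLp_comp_add {p : ENNReal} (a d : ℝ) (hd : 0 ≤ d) {m n : ℕ} (hm : m < n) {h : ℝ → ℂ}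
    (hL : MemLp h p (volume.restrict (Set.Ioc a (a + n * d)))) :
    MemLp (fun x => h (x + m * d)) p (volume.restrict (Set.Ioc a (a + d))) :=
  (hL.mono_measure (map_restrict_le a d hd hm)).comp_of_map (by fun_prop)

theorem setIntegral_Ioc_eq_sum (a d : ℝ) (hd : 0 ≤ d) (n : ℕ) {h : ℝ → ℂ}
    (hi : IntegrableOn h (Set.Ioc a (a + n * d))) :
    ∫ x in Set.Ioc a (a + n * d), h x =
      ∫ x in Set.Ioc a (a + d), ∑ m ∈ Finset.range n, h (x + m * d) := by
  rw [integral_finsetSum, restrict_Ioc_eq_sum_map a d hd n, integral_finsetSum_measure]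
  · exact Finset.sum_congr rfl fun m _ =>
      (measurableEmbedding_addRight ((m : ℝ) * d)).integral_map h
  · exact fun m hm => Integrable.mono_measure hi (map_restrict_le a d hd (Finset.mem_range.mp hm))
  · intro m hm
    have := memLp_comp_add a d hd (Finset.mem_range.mp hm) (memLp_one_iff_integrable.mpr hi)
    exact memLp_one_iff_integrable.mp this

theorem setLIntegral_Ioc_eq_sum (a d : ℝ) (hd : 0 ≤ d) (n : ℕ) {h : ℝ → ENNReal}
    (hm : Measurable h) :
    ∫⁻ x in Set.Ioc a (a + n * d), h x =
      ∫⁻ x in Set.Ioc a (a + d), ∑ m ∈ Finset.range n, h (x + m * d) := by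
  rw [lintegral_finsetSum (f := fun (m : ℕ) (x : ℝ) => h (x + m * d)) _
    fun m _ => hm.comp (by fun_prop), restrict_Ioc_eq_sum_map a d hd n,
    lintegral_finsetSum_measure]
  exact Finset.sum_congr rfl fun m _ => lintegral_map hm (by fun_prop)

/-! ### Parseval's identity and sampling of band-limited functions -/

/-- Parseval on an interval of length `1/T`, where the characters of frequency `kT` form an
orthogonal basis. -/
theorem tsum_enorm_sq_integral_char (a T : ℝ) (hT : 0 < T) {P : ℝ → ℂ}
    (hP : MemLp P 2 (volume.restrict (Set.Ioc a (a + T⁻¹)))) :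
    ∑' k : ℤ, ‖∫ ν in Set.Ioc a (a + T⁻¹),
        P ν * exp (2 * Real.pi * I * ν * ((k * T : ℝ) : ℂ))‖ₑ ^ 2 =
      ENNReal.ofReal T⁻¹ * ∫⁻ ν in Set.Ioc a (a + T⁻¹), ‖P ν‖ₑ ^ 2 := by
  have hab : a < a + T⁻¹ := by simpa using hT
  have hsum := hasSum_sq_fourierCoeffOn hab hP
  -- Fourier coefficients carry the conjugate character, hence `-k`; they are averages over length
  -- `1/T`, hence the factor `T ^ 2`.
  have hcoef : ∀ k : ℤ, ‖fourierCoeffOn hab P (-k)‖ ^ 2 = T ^ 2 * ‖∫ ν in Set.Ioc a (a + T⁻¹),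
      P ν * exp (2 * Real.pi * I * ν * ((k * T : ℝ) : ℂ))‖ ^ 2 := by
    intro k
    rw [fourierCoeffOn_eq_integral, intervalIntegral.integral_of_le hab.le, norm_smul, mul_pow]
    congr 1
    · simp
    · congr 2
      refine integral_congr_ae (Filter.Eventually.of_forall fun ν => ?_)
      simp only [neg_neg, smul_eq_mul]
      rw [mul_comm, fourier_coe_apply]
      congr 2
      push_cast
      rw [add_sub_cancel_left, div_inv_eq_mul]
      ring
  have h2 : HasSum (fun k : ℤ => ‖∫ ν in Set.Ioc a (a + T⁻¹),
      P ν * exp (2 * Real.pi * I * ν * ((k * T : ℝ) : ℂ))‖ ^ 2)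
      (T⁻¹ * ∫ ν in Set.Ioc a (a + T⁻¹), ‖P ν‖ ^ 2) := by
    have h3 := (((Equiv.neg ℤ).hasSum_iff).mpr hsum).mul_left ((T ^ 2)⁻¹)
    rw [intervalIntegral.integral_of_le hab.le, add_sub_cancel_left, smul_eq_mul] at h3
    have h4 : (T ^ 2)⁻¹ * (T⁻¹⁻¹ * ∫ ν in Set.Ioc a (a + T⁻¹), ‖P ν‖ ^ 2) =
        T⁻¹ * ∫ ν in Set.Ioc a (a + T⁻¹), ‖P ν‖ ^ 2 := by
      field_simp
    rw [h4] at h3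
    refine h3.congr_fun fun k => ?_
    simp only [Function.comp_apply, Equiv.neg_apply, hcoef]
    rw [inv_mul_cancel_left₀ (by positivity)]
  simp only [enorm_sq_eq_ofReal]
  rw [← ENNReal.ofReal_tsum_of_nonneg (fun _ => by positivity) h2.summable, h2.tsum_eq,
    ENNReal.ofReal_mul (by positivity), ofReal_integral_eq_lintegral_ofReal]
  · exact hP.integrable_norm_pow (by norm_num)
  · exact Filter.Eventually.of_forall fun _ => by positivity

theorem norm_exp_two_pi_I (ν x : ℝ) : ‖exp (2 * Real.pi * I * ν * x)‖ = 1 := by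
  have : (2 * Real.pi * I * ν * x : ℂ) = ((2 * Real.pi * ν * x : ℝ) : ℂ) * I := by
    push_cast; ring
  rw [this, Complex.norm_exp_ofReal_mul_I]

theorem memLp_mul_of_continuous {p : ENNReal} {a b : ℝ} {h q : ℝ → ℂ} (hq : Continuous q)
    (hL : MemLp h p (volume.restrict (Set.Ioc a b))) :
    MemLp (fun ν => h ν * q ν) p (volume.restrict (Set.Ioc a b)) := by
  obtain ⟨C, hC⟩ := (isCompact_Icc (a := a) (b := b)).exists_bound_of_continuousOn
    hq.continuousOn
  refine MemLp.of_le_mul (c := C) hL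
    (hL.aestronglyMeasurable.mul hq.aestronglyMeasurable) ?_
  filter_upwards [ae_restrict_mem measurableSet_Ioc] with ν hν
  rw [norm_mul, mul_comm C]
  exact mul_le_mul_of_nonneg_left (hC ν (Set.Ioc_subset_Icc_self hν)) (norm_nonneg _)

theorem exp_add_int_mul_inv (ν T : ℝ) (hT : 0 < T) (m : ℕ) (k : ℤ) :
    exp (2 * Real.pi * I * ((ν + m * T⁻¹ : ℝ) : ℂ) * ((k * T : ℝ) : ℂ)) =
      exp (2 * Real.pi * I * ν * ((k * T : ℝ) : ℂ)) := by
  rw [← Complex.exp_periodic.int_mul (m * k) (2 * Real.pi * I * ν * ((k * T : ℝ) : ℂ))]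
  congr 1
  have : (T : ℂ) ≠ 0 := by exact_mod_cast hT.ne'
  push_cast
  field_simp

/-- Aliasing: the characters of frequency `kT` are `1/T`-periodic in `ν`, so the integral collapses
to one cell, with the translates of the weighted function added up, and Parseval applies there. -/
theorem tsum_enorm_sq_moment (a T : ℝ) (hT : 0 < T) (n j : ℕ) {h : ℝ → ℂ}
    (hL : MemLp h 2 (volume.restrict (Set.Ioc a (a + n * T⁻¹)))) :
    ∑' k : ℤ, ‖∫ ν in Set.Ioc a (a + n * T⁻¹), h ν * (2 * Real.pi * I * ν) ^ j *
        exp (2 * Real.pi * I * ν * ((k * T : ℝ) : ℂ))‖ₑ ^ 2 =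
      ENNReal.ofReal T⁻¹ * ∫⁻ ν in Set.Ioc a (a + T⁻¹),
        ‖∑ m ∈ Finset.range n, (2 * Real.pi * I * ((ν + m * T⁻¹ : ℝ) : ℂ)) ^ j *
          h (ν + m * T⁻¹)‖ₑ ^ 2 := by
  have hd : 0 ≤ T⁻¹ := by positivity
  have hE := memLp_mul_of_continuous
    (show Continuous fun ν : ℝ => (2 * Real.pi * I * ν : ℂ) ^ j by fun_prop) hL
  rw [← tsum_enorm_sq_integral_char a T hT]
  · refine tsum_congr fun k => ?_
    rw [setIntegral_Ioc_eq_sum a T⁻¹ hd n]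
    · congr 3
      funext ν
      rw [Finset.sum_mul]
      refine Finset.sum_congr rfl fun m _ => ?_
      rw [exp_add_int_mul_inv ν T hT, mul_comm (h _)]
    · exact (memLp_mul_of_continuous (show Continuous fun ν : ℝ =>
        exp (2 * Real.pi * I * ν * ((k * T : ℝ) : ℂ)) by fun_prop) hE).integrable (by norm_num)
  · refine memLp_finsetSum _ fun m hm => ?_
    simpa only [mul_comm] using memLp_comp_add a T⁻¹ hd (Finset.mem_range.mp hm) hE

theorem exists_moment_upper_bound (a T : ℝ) (hT : 0 < T) (n j : ℕ) :
    ∃ C : ℝ, 0 < C ∧ ∀ h : ℝ → ℂ, Measurable h →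
      MemLp h 2 (volume.restrict (Set.Ioc a (a + n * T⁻¹))) →
      ∑' k : ℤ, ‖∫ ν in Set.Ioc a (a + n * T⁻¹), h ν * (2 * Real.pi * I * ν) ^ j *
          exp (2 * Real.pi * I * ν * ((k * T : ℝ) : ℂ))‖ₑ ^ 2 ≤
        ENNReal.ofReal C * ∫⁻ ν in Set.Ioc a (a + n * T⁻¹), ‖h ν‖ₑ ^ 2 := by
  obtain ⟨C, hC, hV⟩ := exists_vandermonde_upper_bound n j a (a + T⁻¹) T⁻¹
  refine ⟨T⁻¹ * C, by positivity, fun h hm hL => ?_⟩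
  rw [tsum_enorm_sq_moment a T hT n j hL, ENNReal.ofReal_mul (by positivity),
    mul_assoc (ENNReal.ofReal _)]
  gcongr
  rw [setLIntegral_Ioc_eq_sum a T⁻¹ (by positivity) n (h := fun ν => ‖h ν‖ₑ ^ 2) (by fun_prop),
    ← lintegral_const_mul' _ _ ENNReal.ofReal_ne_top]
  refine setLIntegral_mono' measurableSet_Ioc fun ν hν => ?_
  simp only [enorm_sq_eq_ofReal]
  rw [← ENNReal.ofReal_sum_of_nonneg fun _ _ => by positivity, ← ENNReal.ofReal_mul hC.le]
  exact ENNReal.ofReal_le_ofReal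
    (hV ν (Set.Ioc_subset_Icc_self hν) fun m => h (ν + m * T⁻¹))

theorem exists_moment_lower_bound (a T : ℝ) (hT : 0 < T) (n : ℕ) :
    ∃ c : ℝ, 0 < c ∧ ∀ h : ℝ → ℂ, Measurable h →
      MemLp h 2 (volume.restrict (Set.Ioc a (a + n * T⁻¹))) →
      ENNReal.ofReal c * ∫⁻ ν in Set.Ioc a (a + n * T⁻¹), ‖h ν‖ₑ ^ 2 ≤
        ∑ j ∈ Finset.range n, ∑' k : ℤ,
          ‖∫ ν in Set.Ioc a (a + n * T⁻¹), h ν * (2 * Real.pi * I * ν) ^ j *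
            exp (2 * Real.pi * I * ν * ((k * T : ℝ) : ℂ))‖ₑ ^ 2 := by
  obtain ⟨c, hc, hV⟩ := exists_vandermonde_lower_bound n a (a + T⁻¹) T⁻¹ (by positivity)
  refine ⟨T⁻¹ * c, by positivity, fun h hm hL => ?_⟩
  rw [Finset.sum_congr rfl fun j _ => tsum_enorm_sq_moment a T hT n j hL, ← Finset.mul_sum,
    ENNReal.ofReal_mul (by positivity),
    mul_assoc (ENNReal.ofReal _)]
  gcongr
  rw [setLIntegral_Ioc_eq_sum a T⁻¹ (by positivity) n (h := fun ν => ‖h ν‖ₑ ^ 2) (by fun_prop),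
    ← lintegral_const_mul' _ _ ENNReal.ofReal_ne_top,
    ← lintegral_finsetSum _ fun j _ => by fun_prop]
  refine setLIntegral_mono' measurableSet_Ioc fun ν hν => ?_
  simp only [enorm_sq_eq_ofReal]
  rw [← ENNReal.ofReal_sum_of_nonneg fun _ _ => by positivity,
    ← ENNReal.ofReal_sum_of_nonneg fun _ _ => by positivity, ← ENNReal.ofReal_mul hc.le]
  exact ENNReal.ofReal_le_ofReal
    (hV ν (Set.Ioc_subset_Icc_self hν) fun m => h (ν + m * T⁻¹))

/-! ### Square integrability through lower integrals -/

theorem eLpNorm_two_sq {α : Type*} [MeasurableSpace α] (μ : Measure α) (f : α → ℂ) :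
    eLpNorm f 2 μ ^ 2 = ∫⁻ x, ‖f x‖ₑ ^ 2 ∂μ := by
  have h := eLpNorm_nnreal_pow_eq_lintegral (μ := μ) (f := f) (p := 2) two_ne_zero
  simpa using h

theorem memLp_two_of_lintegral_lt_top {α : Type*} [MeasurableSpace α] {μ : Measure α} {f : α → ℂ}
    (hf : AEStronglyMeasurable f μ) (h : ∫⁻ x, ‖f x‖ₑ ^ 2 ∂μ < ⊤) : MemLp f 2 μ := by
  refine ⟨hf, ?_⟩
  rw [← eLpNorm_two_sq] at h
  exact (ENNReal.pow_lt_top_iff.mp h).resolve_right two_ne_zero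

theorem lintegral_lt_top_of_memLp_two {α : Type*} [MeasurableSpace α] {μ : Measure α} {f : α → ℂ}
    (hf : MemLp f 2 μ) : ∫⁻ x, ‖f x‖ₑ ^ 2 ∂μ < ⊤ := by
  rw [← eLpNorm_two_sq]
  exact ENNReal.pow_lt_top hf.2

theorem ofReal_norm_sq_Lp {α : Type*} [MeasurableSpace α] {μ : Measure α} (f : Lp ℂ 2 μ) :
    ENNReal.ofReal (‖f‖ ^ 2) = ∫⁻ x, ‖f x‖ₑ ^ 2 ∂μ := by
  rw [← eLpNorm_two_sq, ENNReal.ofReal_pow (norm_nonneg _), ofReal_norm, Lp.enorm_def]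

theorem ae_memLp_two_slice {α β : Type*} [MeasurableSpace α] [MeasurableSpace β] {μ : Measure α}
    {ν : Measure β} [SFinite μ] [SFinite ν] {f : α × β → ℂ} (hf : StronglyMeasurable f)
    (h : MemLp f 2 (μ.prod ν)) : ∀ᵐ x ∂μ, MemLp (fun y => f (x, y)) 2 ν := by
  have h1 := lintegral_lt_top_of_memLp_two h
  have hm : Measurable fun p => ‖f p‖ₑ ^ 2 := hf.measurable.enorm.pow_const 2
  rw [lintegral_prod _ hm.aemeasurable] at h1
  filter_upwards [ae_lt_top hm.lintegral_prod_right' h1.ne] with x hx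
  exact memLp_two_of_lintegral_lt_top
    (hf.comp_measurable measurable_prodMk_left).aestronglyMeasurable hx

/-! ### Moments of a spreading function, unfolded to the line -/

theorem volume_eq_sum_map (T : ℝ) (hT : 0 < T) :
    (volume : Measure ℝ) = Measure.sum fun k : ℤ =>
      (volume.restrict (Set.Ico 0 T)).map (fun x : ℝ => x + k * T) := by
  have h1 : ∀ k : ℤ, (volume.restrict (Set.Ico 0 T)).map (fun x : ℝ => x + k * T) =
      volume.restrict (Set.Ico (k • T) ((k + 1) • T)) := by
    intro k
    have h := Measure.restrict_map (μ := (volume : Measure ℝ)) (f := fun x : ℝ => x + k * T)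
      (by fun_prop) (measurableSet_Ico (a := k • T) (b := (k + 1) • T))
    rw [map_add_right_eq_self, Set.preimage_add_const_Ico] at h
    rw [h]
    congr 3 <;> simp [add_mul]
  simp only [h1]
  rw [← Measure.restrict_iUnion (Set.pairwise_disjoint_Ico_zsmul T) fun _ => measurableSet_Ico,
    iUnion_Ico_zsmul hT, Measure.restrict_univ]

/-- The function whose value at `t + kT`, `0 ≤ t < T`, is
`∫_{(a, b]} η(t, ν) (2πiν)^l e^{2πiν(t + kT)} dν`. -/
def bandMoment (η : ℝ × ℝ → ℂ) (T a b : ℝ) (l : ℕ) (x : ℝ) : ℂ :=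
  ∫ ν in Set.Ioc a b, η (T * Int.fract (x / T), ν) * (2 * Real.pi * I * ν) ^ l *
    exp (2 * Real.pi * I * ν * x)

theorem stronglyMeasurable_bandMoment {η : ℝ × ℝ → ℂ} (hη : StronglyMeasurable η) (T a b : ℝ)
    (l : ℕ) : StronglyMeasurable (bandMoment η T a b l) := by
  have h1 : Measurable fun p : ℝ × ℝ => (T * Int.fract (p.1 / T), p.2) := by
    have h := measurable_fract.comp (measurable_fst.div_const T : Measurable fun p : ℝ × ℝ => p.1 / T)
    exact (h.const_mul T).prodMk measurable_snd
  have h2 : StronglyMeasurable fun p : ℝ × ℝ => η (T * Int.fract (p.1 / T), p.2) *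
      (2 * Real.pi * I * p.2) ^ l * exp (2 * Real.pi * I * p.2 * p.1) :=
    ((hη.comp_measurable h1).mul (by fun_prop : Continuous fun p : ℝ × ℝ =>
      (2 * Real.pi * I * p.2 : ℂ) ^ l).stronglyMeasurable).mul
      (by fun_prop : Continuous fun p : ℝ × ℝ =>
        exp (2 * Real.pi * I * p.2 * p.1)).stronglyMeasurable
  exact StronglyMeasurable.integral_prod_right (f := fun x ν => η (T * Int.fract (x / T), ν) *
      (2 * Real.pi * I * ν) ^ l * exp (2 * Real.pi * I * ν * x)) h2

theorem mul_fract_add_int_mul {T : ℝ} (hT : 0 < T) {t : ℝ} (ht : t ∈ Set.Ico 0 T) (k : ℤ) :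
    T * Int.fract ((t + k * T) / T) = t := by
  rw [add_div, mul_div_cancel_right₀ _ hT.ne', Int.fract_add_intCast, Int.fract_eq_self.mpr
    ⟨div_nonneg ht.1 hT.le, (div_lt_one hT).mpr ht.2⟩, mul_div_cancel₀ _ hT.ne']

theorem bandMoment_add_int_mul (η : ℝ × ℝ → ℂ) {T : ℝ} (hT : 0 < T) (a b : ℝ) (l : ℕ) {t : ℝ}
    (ht : t ∈ Set.Ico 0 T) (k : ℤ) :
    bandMoment η T a b l (t + k * T) = ∫ ν in Set.Ioc a b,
      η (t, ν) * exp (2 * Real.pi * I * ν * t) * (2 * Real.pi * I * ν) ^ l *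
        exp (2 * Real.pi * I * ν * ((k * T : ℝ) : ℂ)) := by
  rw [bandMoment, mul_fract_add_int_mul hT ht]
  congr 1
  funext ν
  have : exp (2 * Real.pi * I * ν * ((t + k * T : ℝ) : ℂ)) =
      exp (2 * Real.pi * I * ν * t) * exp (2 * Real.pi * I * ν * ((k * T : ℝ) : ℂ)) := by
    rw [← Complex.exp_add]
    push_cast
    ring_nf
  rw [this]
  ring

theorem lintegral_enorm_sq_bandMoment {η : ℝ × ℝ → ℂ} (hη : StronglyMeasurable η) {T : ℝ}
    (hT : 0 < T) (a b : ℝ) (l : ℕ) :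
    ∫⁻ x, ‖bandMoment η T a b l x‖ₑ ^ 2 = ∫⁻ t in Set.Ico 0 T, ∑' k : ℤ,
      ‖bandMoment η T a b l (t + k * T)‖ₑ ^ 2 := by
  have hm : Measurable fun x => ‖bandMoment η T a b l x‖ₑ ^ 2 :=
    (stronglyMeasurable_bandMoment hη T a b l).measurable.enorm.pow_const 2
  rw [volume_eq_sum_map T hT, lintegral_sum_measure,
    -- The first rewrite also expanded the measure on the right-hand side; this one restores it.
    ← volume_eq_sum_map T hT, lintegral_tsum
      (f := fun (k : ℤ) t => ‖bandMoment η T a b l (t + k * T)‖ₑ ^ 2)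
      fun k => (hm.comp (by fun_prop)).aemeasurable]
  exact tsum_congr fun k => lintegral_map hm (by fun_prop)

/-- The unimodular factor costs nothing and matches the slices to the integrand in
`bandMoment_add_int_mul`. -/
theorem lintegral_enorm_sq_restrict_prod {η : ℝ × ℝ → ℂ} (hη : StronglyMeasurable η)
    (s u : Set ℝ) :
    ∫⁻ p in s ×ˢ u, ‖η p‖ₑ ^ 2 = ∫⁻ t in s, ∫⁻ ν in u,
      ‖η (t, ν) * exp (2 * Real.pi * I * ν * t)‖ₑ ^ 2 := by
  have hm : Measurable fun p => ‖η p‖ₑ ^ 2 := hη.measurable.enorm.pow_const 2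
  rw [Measure.volume_eq_prod, ← Measure.prod_restrict, lintegral_prod _ hm.aemeasurable]
  refine lintegral_congr fun t => lintegral_congr fun ν => ?_
  rw [enorm_mul, ← ofReal_norm (exp _), norm_exp_two_pi_I, ENNReal.ofReal_one, mul_one]

theorem ae_slice_mul_exp {η : ℝ × ℝ → ℂ} (hη : StronglyMeasurable η) {s : Set ℝ} {a b : ℝ}
    (hL : MemLp η 2 (volume.restrict (s ×ˢ Set.Ioc a b))) :
    ∀ᵐ t ∂volume.restrict s, Measurable (fun ν : ℝ => η (t, ν) * exp (2 * Real.pi * I * ν * t)) ∧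
      MemLp (fun ν : ℝ => η (t, ν) * exp (2 * Real.pi * I * ν * t)) 2
        (volume.restrict (Set.Ioc a b)) := by
  rw [Measure.volume_eq_prod, ← Measure.prod_restrict] at hL
  filter_upwards [ae_memLp_two_slice hη hL] with t ht
  refine ⟨?_, memLp_mul_of_continuous (by fun_prop) ht⟩
  exact (hη.measurable.comp measurable_prodMk_left).mul (by fun_prop)

theorem exists_bandMoment_upper_bound (a T : ℝ) (hT : 0 < T) (n l : ℕ) :
    ∃ C : ℝ, 0 < C ∧ ∀ η : ℝ × ℝ → ℂ, StronglyMeasurable η →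
      MemLp η 2 (volume.restrict (Set.Ico 0 T ×ˢ Set.Ioc a (a + n * T⁻¹))) →
      ∫⁻ x, ‖bandMoment η T a (a + n * T⁻¹) l x‖ₑ ^ 2 ≤
        ENNReal.ofReal C * ∫⁻ p in Set.Ico 0 T ×ˢ Set.Ioc a (a + n * T⁻¹), ‖η p‖ₑ ^ 2 := by
  obtain ⟨C, hC, h⟩ := exists_moment_upper_bound a T hT n l
  refine ⟨C, hC, fun η hη hL => ?_⟩
  rw [lintegral_enorm_sq_bandMoment hη hT, lintegral_enorm_sq_restrict_prod hη,
    ← lintegral_const_mul' _ _ ENNReal.ofReal_ne_top]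
  refine lintegral_mono_ae ?_
  filter_upwards [ae_slice_mul_exp hη hL, ae_restrict_mem measurableSet_Ico] with t ht ht'
  simp only [bandMoment_add_int_mul η hT a _ l ht']
  exact h _ ht.1 ht.2

theorem exists_bandMoment_lower_bound (a T : ℝ) (hT : 0 < T) (n : ℕ) :
    ∃ c : ℝ, 0 < c ∧ ∀ η : ℝ × ℝ → ℂ, StronglyMeasurable η →
      MemLp η 2 (volume.restrict (Set.Ico 0 T ×ˢ Set.Ioc a (a + n * T⁻¹))) →
      ENNReal.ofReal c * ∫⁻ p in Set.Ico 0 T ×ˢ Set.Ioc a (a + n * T⁻¹), ‖η p‖ₑ ^ 2 ≤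
        ∑ l ∈ Finset.range n, ∫⁻ x, ‖bandMoment η T a (a + n * T⁻¹) l x‖ₑ ^ 2 := by
  obtain ⟨c, hc, h⟩ := exists_moment_lower_bound a T hT n
  refine ⟨c, hc, fun η hη hL => ?_⟩
  rw [Finset.sum_congr rfl fun l _ => lintegral_enorm_sq_bandMoment hη hT a _ l,
    lintegral_enorm_sq_restrict_prod hη, ← lintegral_const_mul' _ _ ENNReal.ofReal_ne_top,
    ← lintegral_finsetSum]
  · refine lintegral_mono_ae ?_
    filter_upwards [ae_slice_mul_exp hη hL, ae_restrict_mem measurableSet_Ico] with t ht ht'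
    simp only [bandMoment_add_int_mul η hT a _ _ ht']
    exact h _ ht.1 ht.2
  · intro l _
    refine Measurable.tsum fun k => ?_
    exact ((stronglyMeasurable_bandMoment hη T a _ l).measurable.comp
      (by fun_prop)).enorm.pow_const 2

theorem memLp_bandMoment {a T : ℝ} (hT : 0 < T) {n : ℕ} (l : ℕ) {η : ℝ × ℝ → ℂ}
    (hη : StronglyMeasurable η)
    (hL : MemLp η 2 (volume.restrict (Set.Ico 0 T ×ˢ Set.Ioc a (a + n * T⁻¹)))) :
    MemLp (bandMoment η T a (a + n * T⁻¹) l) 2 volume := by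
  obtain ⟨C, -, h⟩ := exists_bandMoment_upper_bound a T hT n l
  exact memLp_two_of_lintegral_lt_top (stronglyMeasurable_bandMoment hη T a _ l).aestronglyMeasurable
    ((h η hη hL).trans_lt (ENNReal.mul_lt_top ENNReal.ofReal_lt_top
      (lintegral_lt_top_of_memLp_two hL)))

/-! ### The weak action on the Dirac comb -/

/-- Quadratic decay of `g`, made uniform over one period; this dominates the sum over `k` when it is
exchanged with the integral of `η`. -/
theorem exists_summable_bound (N : ℕ) (hN : 0 < N) (g : 𝓢(ℝ, ℂ)) :
    ∃ B : ℤ → ℝ, Summable B ∧ ∀ k : ℤ, ∀ t ∈ Set.Ico (0 : ℝ) N, ‖g (t + k * N)‖ ≤ B k := by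
  obtain ⟨C₀, hC₀, h₀⟩ := g.decay 0 0
  obtain ⟨C₂, hC₂, h₂⟩ := g.decay 2 0
  have hs : Summable fun k : ℤ => 1 / (k : ℝ) ^ 2 := Real.summable_one_div_int_pow.mpr one_lt_two
  refine ⟨fun k => 3 * (C₀ + C₂) / (1 + (k : ℝ) ^ 2), ?_, fun k t ht => ?_⟩
  · refine Summable.of_norm_bounded_eventually (hs.mul_left (3 * (C₀ + C₂))) ?_
    filter_upwards [(Set.finite_singleton (0 : ℤ)).compl_mem_cofinite] with k hk
    have hk' : (k : ℝ) ≠ 0 := by exact_mod_cast hk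
    rw [Real.norm_of_nonneg (by positivity), mul_one_div]
    gcongr
    linarith
  · have h1 := h₀ (t + k * N)
    have h3 := h₂ (t + k * N)
    rw [norm_iteratedFDeriv_zero] at h1 h3
    rw [pow_zero, one_mul] at h1
    rw [Real.norm_eq_abs, sq_abs] at h3
    have hN1 : (1 : ℝ) ≤ N := by exact_mod_cast hN
    have hkt : 1 + (k : ℝ) ^ 2 ≤ 3 * (1 + (t + k * N) ^ 2) := by
      -- Here `N ≥ 1` and `0 ≤ t/N ≤ 1` are used: dividing by `N` does not increase the first term,
      -- and the second is at most `1`.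
      have h4 : |(k : ℝ)| ≤ |t + k * N| + 1 := by
        have h5 : |(k : ℝ)| = |(t + k * N) / N - t / N| := by
          congr 1
          field_simp
          ring
        rw [h5]
        refine (abs_sub _ _).trans (add_le_add ?_ ?_)
        · rw [abs_div, Nat.abs_cast]
          exact div_le_self (abs_nonneg _) hN1
        · rw [abs_of_nonneg (div_nonneg ht.1 (by positivity))]
          exact (div_le_one (by positivity)).mpr ht.2.le
      have h5 : (k : ℝ) ^ 2 ≤ (|t + k * N| + 1) ^ 2 := by
        rw [← sq_abs (k : ℝ)]
        gcongr
      nlinarith [sq_nonneg (|t + k * N| - 1), sq_abs (t + k * N)]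
    rw [le_div_iff₀ (by positivity)]
    calc ‖g (t + k * N)‖ * (1 + (k : ℝ) ^ 2)
        ≤ ‖g (t + k * N)‖ * (3 * (1 + (t + k * N) ^ 2)) := by gcongr
      _ ≤ _ := by linarith

theorem hasSum_impulseTrain_modTranslate (N : ℕ) (hN : 0 < N) (t ν : ℝ) (g : 𝓢(ℝ, ℂ)) :
    HasSum (fun k : ℤ => exp (2 * Real.pi * I * ν * ((t + k * N : ℝ) : ℂ)) * g (t + k * N))
      (impulseTrain N 0 (modTranslate t ν g)) := by
  have h := hasSum_impulseTrain N hN (modTranslate t ν g)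
  simpa only [modTranslate_apply, add_comm _ t] using h

/-- Both integrals equal the same sum over `k`: on the left by expanding the comb and exchanging sum
and integral, on the right by cutting the line into the periods `[kN, (k+1)N)` and applying Fubini.
-/
theorem integrable_and_integral_impulseTrain {N : ℕ} (hN : 0 < N) {a : ℝ} {n : ℕ} (l : ℕ)
    {η : ℝ × ℝ → ℂ} (hη : StronglyMeasurable η)
    (hL : MemLp η 2 (volume.restrict (Set.Ico 0 (N : ℝ) ×ˢ Set.Ioc a (a + n * (N : ℝ)⁻¹))))
    (g : 𝓢(ℝ, ℂ)) :
    IntegrableOn (fun p : ℝ × ℝ => η p * (2 * Real.pi * I * p.2) ^ l *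
        impulseTrain N 0 (modTranslate p.1 p.2 g))
      (Set.Ico 0 (N : ℝ) ×ˢ Set.Ioc a (a + n * (N : ℝ)⁻¹)) ∧
    ∫ p in Set.Ico 0 (N : ℝ) ×ˢ Set.Ioc a (a + n * (N : ℝ)⁻¹), η p *
        (2 * Real.pi * I * p.2) ^ l * impulseTrain N 0 (modTranslate p.1 p.2 g) =
      ∫ x, g x * bandMoment η N a (a + n * (N : ℝ)⁻¹) l x := by
  have hT : (0 : ℝ) < N := by exact_mod_cast hN
  set b : ℝ := a + n * (N : ℝ)⁻¹ with hb
  set S : Set (ℝ × ℝ) := Set.Ico 0 (N : ℝ) ×ˢ Set.Ioc a b with hS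
  have hSm : MeasurableSet S := measurableSet_Ico.prod measurableSet_Ioc
  have hfin : IsFiniteMeasure (volume.restrict S) := by
    rw [hS, Measure.volume_eq_prod, ← Measure.prod_restrict]
    infer_instance
  obtain ⟨B, hB, hgB⟩ := exists_summable_bound N hN g
  let E : ℝ × ℝ → ℂ := fun p => η p * (2 * Real.pi * I * p.2) ^ l
  let G : ℤ → ℝ × ℝ → ℂ := fun k p =>
    exp (2 * Real.pi * I * p.2 * ((p.1 + k * N : ℝ) : ℂ)) * g (p.1 + k * N)
  have hG : ∀ k, Continuous (G k) := fun k => by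
    have := g.continuous
    fun_prop
  have hGB : ∀ k, ∀ p ∈ S, ‖G k p‖ ≤ B k := by
    intro k p hp
    rw [norm_mul, norm_exp_two_pi_I, one_mul]
    exact hgB k p.1 hp.1
  have hGsum : ∀ p : ℝ × ℝ, HasSum (fun k => G k p) (impulseTrain N 0 (modTranslate p.1 p.2 g)) :=
    fun p => hasSum_impulseTrain_modTranslate N hN p.1 p.2 g
  have hE : Integrable E (volume.restrict S) := by
    have h1 : Integrable η (volume.restrict S) := hL.integrable (by norm_num)
    refine h1.mul_bdd (c := (2 * Real.pi * (|a| + |b|)) ^ l)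
      (by fun_prop : Continuous fun p : ℝ × ℝ =>
        (2 * Real.pi * I * p.2 : ℂ) ^ l).aestronglyMeasurable ?_
    filter_upwards [ae_restrict_mem hSm] with p hp
    rw [norm_pow, norm_mul, Complex.norm_real, Real.norm_eq_abs, norm_mul, Complex.norm_I, mul_one,
      norm_mul, Complex.norm_real, Real.norm_of_nonneg Real.pi_pos.le, Complex.norm_ofNat]
    gcongr
    exact (abs_le_max_abs_abs hp.2.1.le hp.2.2).trans (max_le (by simp) (by simp))
  have hF : ∀ k, Integrable (fun p => E p * G k p) (volume.restrict S) := fun k =>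
    hE.mul_bdd (c := B k) (hG k).aestronglyMeasurable
      ((ae_restrict_mem hSm).mono fun p hp => hGB k p hp)
  have hFsum : Summable fun k => ∫ p in S, ‖E p * G k p‖ := by
    refine (hB.mul_left (∫ p in S, ‖E p‖)).of_nonneg_of_le
      (fun k => integral_nonneg fun _ => norm_nonneg _) fun k => ?_
    rw [← integral_mul_const]
    refine integral_mono_ae (hF k).norm (hE.norm.mul_const _) ?_
    filter_upwards [ae_restrict_mem hSm] with p hp
    rw [norm_mul]
    exact mul_le_mul_of_nonneg_left (hGB k p hp) (norm_nonneg _)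
  have h1 := hasSum_integral_of_summable_integral_norm hF hFsum
  have h2 : ∀ p : ℝ × ℝ, ∑' k, E p * G k p = E p * impulseTrain N 0 (modTranslate p.1 p.2 g) :=
    fun p => ((hGsum p).mul_left _).tsum_eq
  simp only [h2] at h1
  have hmom := memLp_bandMoment hT l hη hL
  -- The product is integrable because both factors are in `L²`; no pointwise decay of the moment is
  -- needed.
  have hint : Integrable (fun x => g x * bandMoment η N a b l x) :=
    (g.memLp 2 volume).integrable_mul hmom
  rw [volume_eq_sum_map N hT] at hint
  have h3 := hasSum_integral_measure hint
  rw [← volume_eq_sum_map N hT] at h3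
  refine ⟨?_, h1.unique (h3.congr_fun fun k => ?_)⟩
  · refine hE.mul_bdd (c := ∑' k, B k) ?_ ?_
    · refine aestronglyMeasurable_of_tendsto_ae Filter.atTop
        (f := fun (s : Finset ℤ) p => ∑ k ∈ s, G k p) (fun s => ?_)
        (Filter.Eventually.of_forall hGsum)
      exact (continuous_finsetSum s fun k _ => hG k).aestronglyMeasurable
    · filter_upwards [ae_restrict_mem hSm] with p hp
      rw [← (hGsum p).tsum_eq]
      exact tsum_of_norm_bounded hB.hasSum fun k => hGB k p hp
  · rw [(measurableEmbedding_addRight ((k : ℝ) * N)).integral_map, hS, Measure.volume_eq_prod,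
      ← Measure.prod_restrict, integral_prod _ (by
        have := hF k
        rwa [hS, Measure.volume_eq_prod, ← Measure.prod_restrict] at this)]
    refine integral_congr_ae ?_
    filter_upwards [ae_restrict_mem measurableSet_Ico] with t ht
    rw [bandMoment, mul_fract_add_int_mul hT ht, ← integral_const_mul]
    congr 1
    funext ν
    simp only [E, G]
    ring

/-! ### The spreading function -/

theorem norm_symplecticFourier (f : L2R2) : ‖symplecticFourier f‖ = ‖f‖ := by
  rw [symplecticFourier, Lp.norm_compMeasurePreserving, planeFourier,
    Lp.norm_compMeasurePreserving, Lp.norm_fourier_eq, Lp.norm_compMeasurePreserving]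

/-- Plancherel in the second variable for almost every `x`, followed by invariance of Lebesgue
measure under `t ↦ x - t` and Tonelli. -/
theorem norm_eq_of_isKohnNirenbergSymbol {H : HilbertSchmidtOperator} {σ : L2R2}
    (h : H.IsKohnNirenbergSymbol σ) : ‖σ‖ = H.hsNorm := by
  have hm : ∀ f : L2R2, Measurable fun p => ‖f p‖ₑ ^ 2 := fun f =>
    (Lp.stronglyMeasurable f).measurable.enorm.pow_const 2
  have key : ENNReal.ofReal (‖σ‖ ^ 2) = ENNReal.ofReal (‖H.kernel‖ ^ 2) := by
    have hprod : ∀ f : L2R2, ENNReal.ofReal (‖f‖ ^ 2) = ∫⁻ x, ∫⁻ y, ‖f (x, y)‖ₑ ^ 2 := fun f =>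
      (ofReal_norm_sq_Lp f).trans (lintegral_prod _ (hm f).aemeasurable)
    rw [hprod, hprod]
    refine lintegral_congr_ae (h.mono fun x ⟨hx, hσ⟩ => ?_)
    calc ∫⁻ ξ, ‖σ (x, ξ)‖ₑ ^ 2 = ∫⁻ ξ, ‖(𝓕 hx.toLp : L2R) ξ‖ₑ ^ 2 :=
          lintegral_congr_ae (hσ.mono fun ξ hξ => by
            simp only at hξ ⊢
            rw [hξ])
      _ = ∫⁻ t, ‖(hx.toLp : L2R) t‖ₑ ^ 2 := by
          rw [← ofReal_norm_sq_Lp, Lp.norm_fourier_eq, ofReal_norm_sq_Lp]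
      _ = ∫⁻ t, ‖H.kernel (x, x - t)‖ₑ ^ 2 :=
          lintegral_congr_ae (hx.coeFn_toLp.mono fun t ht => by
            simp only at ht ⊢
            rw [ht])
      _ = ∫⁻ t, ‖H.kernel (x, t)‖ₑ ^ 2 :=
          lintegral_sub_left_eq_self (fun t => ‖H.kernel (x, t)‖ₑ ^ 2) x
  have h2 := (ENNReal.ofReal_eq_ofReal_iff (by positivity) (by positivity)).mp key
  exact (sq_eq_sq₀ (norm_nonneg _) (norm_nonneg _)).mp h2

theorem norm_eq_of_isSpreadingFunction {H : HilbertSchmidtOperator} {η : L2R2}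
    (h : H.IsSpreadingFunction η) : ‖η‖ = H.hsNorm := by
  obtain ⟨σ, hσ, rfl⟩ := h
  rw [norm_symplecticFourier, norm_eq_of_isKohnNirenbergSymbol hσ]

theorem ae_eq_zero_of_notMem_essSupp {f : ℝ × ℝ → ℂ} (hf : StronglyMeasurable f) :
    ∀ᵐ p, p ∉ essSupp f → f p = 0 := by
  have hm : MeasurableSet {p | f p ≠ 0} := hf.measurable (measurableSet_singleton 0).compl
  rw [ae_iff]
  refine measure_null_of_locally_null _ fun p hp => ?_
  simp only [Classical.not_imp, Set.mem_ofPred_eq] at hp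
  have hp1 : ∃ U ∈ 𝓝 p, ∀ᵐ q ∂(volume.restrict U), f q = 0 := by
    simpa [essSupp] using hp.1
  obtain ⟨U, hU, hU0⟩ := hp1
  refine ⟨_, Filter.inter_mem (mem_nhdsWithin_of_mem_nhds hU) self_mem_nhdsWithin, ?_⟩
  rw [ae_iff, Measure.restrict_apply hm] at hU0
  refine measure_mono_null ?_ hU0
  rintro q ⟨hq, hq'⟩
  simp only [Classical.not_imp, Set.mem_ofPred_eq] at hq'
  exact ⟨hq'.2, hq⟩

/-- The boundary of the rectangle is null, so the closed support may be traded for the half-open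
product on which periods and cells tile exactly. -/
theorem ae_eq_zero_of_essSupp_subset_Icc {f : ℝ × ℝ → ℂ} (hf : StronglyMeasurable f)
    {a b a' b' : ℝ} (h : essSupp f ⊆ Set.Icc a b ×ˢ Set.Icc a' b') :
    ∀ᵐ p, p ∉ Set.Ico a b ×ˢ Set.Ioc a' b' → f p = 0 := by
  have hae : (Set.Ico a b ×ˢ Set.Ioc a' b' : Set (ℝ × ℝ)) =ᵐ[volume]
      (Set.Icc a b ×ˢ Set.Icc a' b' : Set (ℝ × ℝ)) := by
    rw [Measure.volume_eq_prod]
    exact Measure.set_prod_ae_eq Ico_ae_eq_Icc Ioc_ae_eq_Icc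
  filter_upwards [ae_eq_zero_of_notMem_essSupp hf, hae.mem_iff] with p hp hp' hn
  exact hp fun hmem => hn (hp'.mpr (h hmem))

theorem toTemperedDistribution_iterate_deriv_apply (l r : ℕ) (w : L2R) (g : 𝓢(ℝ, ℂ)) (z : ℂ) :
    (z • distDeriv (r - l) (Lp.toTemperedDistribution w)) g = z * ((-1) ^ (r - l) *
      ∫ x, ((SchwartzMap.derivCLM ℂ ℂ)^[r - l] g) x * w x) := by
  change z • (distDeriv (r - l) (Lp.toTemperedDistribution w) g) = _
  rw [distDeriv_apply, Lp.toTemperedDistribution_apply]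
  rfl

/-- Expanding the derivatives turns the weak integral into a binomial sum of moment integrals, each
of which is the pairing of a derivative of `g` with `w l`. The vanishing of `η` off the rectangle
reduces the plane integral to it. -/
theorem mapsTo_impulseTrain {H : HilbertSchmidtOperator} {η : L2R2} (hη : H.IsSpreadingFunction η)
    {N : ℕ} (hN : 0 < N) {a : ℝ} {n : ℕ}
    (h0 : ∀ᵐ p, p ∉ Set.Ico 0 (N : ℝ) ×ˢ Set.Ioc a (a + n * (N : ℝ)⁻¹) → η p = 0)
    (w : ℕ → L2R) (hw : ∀ l, w l =ᵐ[volume] bandMoment η N a (a + n * (N : ℝ)⁻¹) l) (r : ℕ) :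
    H.MapsTo (impulseTrain N r) (∑ l ∈ Finset.range (r + 1),
      ((r.choose l : ℂ) * (-1) ^ l) • distDeriv (r - l) (Lp.toTemperedDistribution (w l))) := by
  refine ⟨η, hη, fun g => ?_⟩
  set S : Set (ℝ × ℝ) := Set.Ico 0 (N : ℝ) ×ˢ Set.Ioc a (a + n * (N : ℝ)⁻¹) with hS
  have hL : MemLp η 2 (volume.restrict S) := (Lp.memLp η).restrict S
  have hterm := fun l => integrable_and_integral_impulseTrain (a := a) (n := n) hN l
    (Lp.stronglyMeasurable η) hL ((SchwartzMap.derivCLM ℂ ℂ)^[r - l] g)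
  rw [← hS] at hterm
  have hexp : (fun p : ℝ × ℝ => η p * freqShift p.2 (timeShift p.1 (impulseTrain N r)) g) =
      fun p => ∑ l ∈ Finset.range (r + 1), ((-1) ^ r * (r.choose l : ℂ)) *
        (η p * (2 * Real.pi * I * p.2) ^ l * impulseTrain N 0 (modTranslate p.1 p.2
          ((SchwartzMap.derivCLM ℂ ℂ)^[r - l] g))) := by
    funext p
    rw [freqShift_timeShift_eq, impulseTrain_modTranslate N r hN, Finset.mul_sum]
    exact Finset.sum_congr rfl fun l _ => by ring
  have hz : ∀ᵐ p : ℝ × ℝ, p ∉ S →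
      η p * freqShift p.2 (timeShift p.1 (impulseTrain N r)) g = 0 :=
    h0.mono fun p hp hn => by rw [hp hn, zero_mul]
  have hi : IntegrableOn (fun p : ℝ × ℝ =>
      η p * freqShift p.2 (timeShift p.1 (impulseTrain N r)) g) S := by
    rw [hexp]
    exact integrable_finsetSum _ fun l _ => (hterm l).1.const_mul _
  refine ⟨hi.integrable_of_ae_notMem_eq_zero hz, ?_⟩
  rw [← setIntegral_eq_integral_of_ae_compl_eq_zero hz, hexp,
    integral_finsetSum _ fun l _ => (hterm l).1.const_mul _]
  have hsum : ∀ (s : Finset ℕ) (F : ℕ → 𝓢'(ℝ, ℂ)), (∑ l ∈ s, F l) g = ∑ l ∈ s, F l g := by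
    intro s F
    induction s using Finset.induction_on with
    | empty => rfl
    | insert i s hi ih => rw [Finset.sum_insert hi, Finset.sum_insert hi, ← ih]; rfl
  rw [hsum]
  refine Finset.sum_congr rfl fun l hl => ?_
  have hlr : l ≤ r := Nat.lt_succ_iff.mp (Finset.mem_range.mp hl)
  rw [toTemperedDistribution_iterate_deriv_apply, integral_const_mul, (hterm l).2]
  have hI : ∫ x, ((SchwartzMap.derivCLM ℂ ℂ)^[r - l] g) x * w l x =
      ∫ x, ((SchwartzMap.derivCLM ℂ ℂ)^[r - l] g) x * bandMoment η N a (a + n * (N : ℝ)⁻¹) l x :=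
    integral_congr_ae ((hw l).mono fun x hx => by
      simp only at hx ⊢
      rw [hx])
  rw [hI, ← mul_assoc]
  congr 1
  -- The sign `(-1)^r` from the pulse splits: `(-1)^(r-l)` is absorbed by the distributional
  -- derivative of `w l`, and `(-1)^l` remains as coefficient.
  have hpow : (-1 : ℂ) ^ r = (-1) ^ l * (-1) ^ (r - l) := by
    rw [← pow_add, Nat.add_sub_cancel' hlr]
  rw [hpow]
  ring

end OperatorSampling

end

/-! ### The two-sided norm estimate -/

open OperatorSampling
theorem theorem5p5 (M N : ℕ) (hM : 0 < M) (hN : 0 < N) :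
    ∃ c C : ℝ, 0 < c ∧ 0 < C ∧
      ∀ H ∈ OPW (Set.Icc (0 : ℝ) N ×ˢ Set.Icc (-(M : ℝ) / 2) ((M : ℝ) / 2)),
        ∃ T : ℕ → 𝓢'(ℝ, ℂ), (∀ r : ℕ, H.MapsTo (impulseTrain N r) (T r)) ∧
        ∃ u : ℕ → L2R,
          (∀ j < M * N,
            ∑ r ∈ Finset.range (j + 1), ((j.choose r : ℂ) * (-1) ^ r) • distDeriv (j - r) (T r) =
              Lp.toTemperedDistribution (u j)) ∧
          c * H.hsNorm ^ 2 ≤ ∑ j ∈ Finset.range (M * N), ‖u j‖ ^ 2 ∧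
          ∑ j ∈ Finset.range (M * N), ‖u j‖ ^ 2 ≤ C * H.hsNorm ^ 2 := by
  have hT : (0 : ℝ) < N := by exact_mod_cast hN
  obtain ⟨c, hc, hlow⟩ := exists_bandMoment_lower_bound (-(M : ℝ) / 2) N hT (M * N)
  choose C hC hup using fun l => exists_bandMoment_upper_bound (-(M : ℝ) / 2) N hT (M * N) l
  have hMN : 0 < M * N := Nat.mul_pos hM hN
  -- Each moment is bounded above separately, so the upper constants add; the lower constant needs
  -- all `M * N` moments at once.
  refine ⟨c, ∑ j ∈ Finset.range (M * N), C j, hc,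
    Finset.sum_pos (fun j _ => hC j) ⟨0, Finset.mem_range.mpr hMN⟩, ?_⟩
  rintro H ⟨η, hη, hsupp⟩
  -- The band has length `M = MN · (1/N)`: exactly as many cells as there are moments, so the
  -- Vandermonde system is square.
  have hb : -(M : ℝ) / 2 + (M * N : ℕ) * (N : ℝ)⁻¹ = M / 2 := by
    push_cast
    field_simp
    ring
  have hsm : StronglyMeasurable η := Lp.stronglyMeasurable η
  have h0 := ae_eq_zero_of_essSupp_subset_Icc hsm hsupp
  rw [← hb] at h0
  set b : ℝ := -(M : ℝ) / 2 + (M * N : ℕ) * (N : ℝ)⁻¹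
  have hL : MemLp η 2 (volume.restrict (Set.Ico 0 (N : ℝ) ×ˢ Set.Ioc (-(M : ℝ) / 2) b)) :=
    (Lp.memLp η).restrict _
  have hnorm : ∫⁻ p in Set.Ico 0 (N : ℝ) ×ˢ Set.Ioc (-(M : ℝ) / 2) b, ‖η p‖ₑ ^ 2 =
      ENNReal.ofReal (H.hsNorm ^ 2) := by
    rw [← norm_eq_of_isSpreadingFunction hη, ofReal_norm_sq_Lp,
      ← lintegral_indicator (measurableSet_Ico.prod measurableSet_Ioc)]
    refine lintegral_congr_ae (h0.mono fun p hp => ?_)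
    refine Set.indicator_apply_eq_self.mpr fun hn => ?_
    simp [hp hn]
  have hmem := fun l => memLp_bandMoment hT l hsm hL
  let w : ℕ → L2R := fun l => (hmem l).toLp
  have hwn : ∀ l, ENNReal.ofReal (‖w l‖ ^ 2) = ∫⁻ x, ‖bandMoment η N (-(M : ℝ) / 2) b l x‖ₑ ^ 2 :=
    fun l => by
      rw [ofReal_norm_sq_Lp]
      exact lintegral_congr_ae ((hmem l).coeFn_toLp.mono fun x hx => by
        simp only at hx ⊢
        rw [hx])
  -- The witness for `u` is `w` itself, by binomial inversion.
  refine ⟨_, mapsTo_impulseTrain hη hN h0 w fun l => (hmem l).coeFn_toLp, w,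
    fun j _ => sum_choose_distDeriv_inversion (fun l => Lp.toTemperedDistribution (w l)) j, ?_, ?_⟩
  · have h := hlow η hsm hL
    rw [← Finset.sum_congr rfl fun l _ => hwn l, hnorm, ← ENNReal.ofReal_mul hc.le,
      ← ENNReal.ofReal_sum_of_nonneg fun _ _ => by positivity] at h
    exact (ENNReal.ofReal_le_ofReal_iff (by positivity)).mp h
  · rw [Finset.sum_mul]
    refine Finset.sum_le_sum fun j _ => ?_
    have h := hup j η hsm hL
    rw [← hwn j, hnorm, ← ENNReal.ofReal_mul (hC j).le] at h
    exact (ENNReal.ofReal_le_ofReal_iff (mul_nonneg (hC j).le (by positivity))).mp h
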